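/- Let $X$ be an oval, i.e. a closed simple convex $C^2$ curve in $\mathbb R^2$ with positive curvature, parametrized counterclockwise by the angle $\theta\in\mathbb S^1=\mathbb R/2\pi\mathbb Z$ which its tangent makes with a fixed direction. Let $B:\mathbb S^1\times(0,\pi)\to\mathbb S^1\times(0,\pi)$ be the billiard map of the table bounded by $X$: $B(\theta,\phi)=(\theta_1,\phi_1)$, where $X(\theta_1)$ is the point other than $X(\theta)$ at which the ray that leaves $X(\theta)$ inward at angle $\phi$ with the tangent meets $X$, and $\phi_1$ is the angle with the tangent at $X(\theta_1)$ after elastic reflection. Let $\Gamma=\{(\theta,\phi):\phi=\pi/2\}$ be the orthogonal wavefront. Suppose that for every positive integer $n$ the set $B^n(\Gamma)$ is a graph over $\Gamma$, i.e. $B^n(\Gamma)=\{(\theta,g_n(\theta)):\theta\in\mathbb S^1\}$ for some function $g_n:\mathbb S^1\to(0,\pi)$. Then $B(\Gamma)=\Gamma$, and the boundary $X$ of the billiard table is a curve of constant width, i.e. the distance between its two parallel supporting lines orthogonal to a direction does not depend on the direction. -/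

import Mathlib

open Set

noncomputable section

namespace Billiard

/-- The Euclidean plane. -/
abbrev Plane : Type := EuclideanSpace ℝ (Fin 2)

/-- The unit vector `T(θ)` making the angle `θ` with the first coordinate axis. -/
def T (θ : Real.Angle) : Plane := !₂[θ.cos, θ.sin]

/-- The unit vector `N(θ) = T'(θ)`, obtained from `T(θ)` by a counterclockwise quarter turn. -/
def N (θ : Real.Angle) : Plane := !₂[-θ.sin, θ.cos]

/-- An oval: a closed plane curve of class `C²` with positive curvature, parametrized by the angle
`θ ∈ ℝ / 2πℤ` which its (counterclockwise) tangent makes with a fixed direction; `R` is the radius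
of curvature, so that `X' = R T`, and `N` is the inward normal.
Since the tangent turns exactly once, such a curve is automatically simple and strictly convex. -/
structure Oval where
  /-- the parametrization by the tangent angle -/
  X : Real.Angle → Plane
  /-- the radius of curvature -/
  R : Real.Angle → ℝ
  continuous_R : Continuous R
  R_pos : ∀ θ, 0 < R θ
  hasDerivAt_X : ∀ θ : ℝ, HasDerivAt (fun s : ℝ => X (s : Real.Angle)) (R θ • T θ) θ

/-- The phase cylinder `𝕊¹ × (0, π)`. -/
abbrev Phase : Type := Real.Angle × Ioo (0 : ℝ) Real.pi

/-- The unit vector at `X(θ)` which makes the angle `φ` with the tangent `T(θ)`, pointing inward. -/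
def dirOut (p : Phase) : Plane :=
  Real.cos p.2 • T p.1 + Real.sin p.2 • N p.1

/-- The mirror image of `dirOut p` in the tangent line at `X(θ)`: the direction in which a particle
arrives at `X(θ)` that leaves with angle `φ` after an elastic reflection. -/
def dirIn (p : Phase) : Plane :=
  Real.cos p.2 • T p.1 - Real.sin p.2 • N p.1

namespace Oval

/-- `q = (θ₁, φ₁)` is the next impact after `p = (θ, φ)`: the ray that leaves `X(θ)` at angle `φ`
meets the curve again at `X(θ₁)`, and is reflected there at angle `φ₁`. -/
def IsNextImpact (C : Oval) (p q : Phase) : Prop :=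
  (∃ l : ℝ, 0 < l ∧ C.X q.1 = C.X p.1 + l • dirOut p) ∧ dirIn q = dirOut p

end Oval

/- The facts which show that the next impact exists and is unique. -/

lemma dirOut_eq (p : Phase) : dirOut p = T (p.1 + ((p.2 : ℝ) : Real.Angle)) := by
  ext i
  fin_cases i <;> simp [dirOut, T, N, Real.Angle.cos_add, Real.Angle.sin_add] <;> ring

lemma dirIn_eq (p : Phase) : dirIn p = T (p.1 - ((p.2 : ℝ) : Real.Angle)) := by
  ext i
  fin_cases i <;>
    simp [dirIn, T, N, sub_eq_add_neg, Real.Angle.cos_add, Real.Angle.sin_add] <;> ring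

lemma T_injective : Function.Injective T := by
  intro x y h
  have h0 := congrArg (fun v : Plane => v 0) h
  have h1 := congrArg (fun v : Plane => v 1) h
  simp only [T] at h0 h1
  induction x using Real.Angle.induction_on with
  | _ a =>
    induction y using Real.Angle.induction_on with
    | _ b =>
      exact Real.Angle.cos_sin_inj (by simpa using h0) (by simpa using h1)

lemma decomp (ψ : Real.Angle) (w : Plane) :
    w = inner ℝ (T ψ) w • T ψ + inner ℝ (N ψ) w • N ψ := by
  have h := Real.Angle.cos_sq_add_sin_sq ψ
  ext i
  fin_cases i
  · simp [T, N, PiLp.inner_apply, Fin.sum_univ_two]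
    linear_combination (-(w 0)) * h
  · simp [T, N, PiLp.inner_apply, Fin.sum_univ_two]
    linear_combination (-(w 1)) * h

lemma inner_N_T (ψ s : ℝ) : inner ℝ (N ψ) (T s) = Real.sin (s - ψ) := by
  simp [T, N, PiLp.inner_apply, Fin.sum_univ_two, Real.sin_sub]
  ring

namespace Oval

variable (C : Oval)

lemma hasDerivAt_inner (ψ s : ℝ) :
    HasDerivAt (fun s : ℝ => inner ℝ (N ψ) (C.X s)) (C.R s * Real.sin (s - ψ)) s := by
  have h := (innerSL ℝ (N (ψ : Real.Angle))).hasFDerivAt.comp_hasDerivAt s (C.hasDerivAt_X s)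
  have e : C.R s * Real.sin (s - ψ) = innerSL ℝ (N (ψ : Real.Angle)) (C.R s • T s) := by
    rw [innerSL_apply_apply, inner_smul_right, inner_N_T]
  rw [e]
  exact h

lemma continuous_inner (ψ : ℝ) : Continuous (fun s : ℝ => inner ℝ (N ψ) (C.X s)) :=
  continuous_iff_continuousAt.2 fun s => (C.hasDerivAt_inner ψ s).continuousAt

lemma strictMono_inner (ψ : ℝ) :
    StrictMonoOn (fun s : ℝ => inner ℝ (N ψ) (C.X s)) (Icc ψ (ψ + Real.pi)) := by
  apply strictMonoOn_of_deriv_pos (convex_Icc _ _) (C.continuous_inner ψ).continuousOn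
  intro s hs
  rw [interior_Icc] at hs
  rw [(C.hasDerivAt_inner ψ s).deriv]
  exact mul_pos (C.R_pos _) (Real.sin_pos_of_pos_of_lt_pi (by linarith [hs.1]) (by linarith [hs.2]))

lemma strictAnti_inner (ψ : ℝ) :
    StrictAntiOn (fun s : ℝ => inner ℝ (N ψ) (C.X s)) (Icc (ψ - Real.pi) ψ) := by
  apply strictAntiOn_of_deriv_neg (convex_Icc _ _) (C.continuous_inner ψ).continuousOn
  intro s hs
  rw [interior_Icc] at hs
  rw [(C.hasDerivAt_inner ψ s).deriv]
  exact mul_neg_of_pos_of_neg (C.R_pos _)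
    (Real.sin_neg_of_neg_of_neg_pi_lt (by linarith [hs.2]) (by linarith [hs.1]))

lemma X_sub_two_pi (s : ℝ) : C.X ((s - 2 * Real.pi : ℝ) : Real.Angle) = C.X s := by
  congr 1
  rw [Real.Angle.coe_sub, Real.Angle.coe_two_pi, sub_zero]

lemma inner_pos {a b : ℝ} (h1 : a < b) (h2 : b < a + 2 * Real.pi) :
    inner ℝ (N a) (C.X a) < inner ℝ (N a) (C.X b) := by
  have hpi := Real.pi_pos
  rcases le_total b (a + Real.pi) with h | h
  · exact C.strictMono_inner a ⟨le_rfl, by linarith⟩ ⟨h1.le, h⟩ h1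
  · have := C.strictAnti_inner a (a := b - 2 * Real.pi) (b := a)
      ⟨by linarith, by linarith⟩ ⟨by linarith, le_rfl⟩ (by linarith)
    simpa only [X_sub_two_pi] using this

theorem existsUnique_nextImpact (p : Phase) : ∃! q, C.IsNextImpact p q := by
  obtain ⟨θ, φ, hφ0, hφπ⟩ := p
  induction θ using Real.Angle.induction_on with
  | _ a =>
  have hpi := Real.pi_pos
  have hout : dirOut ((a : Real.Angle), ⟨φ, hφ0, hφπ⟩) = T ((a + φ : ℝ) : Real.Angle) := by
    rw [dirOut_eq, Real.Angle.coe_add]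
  have hNT : inner ℝ (N ((a + φ : ℝ) : Real.Angle)) (T ((a + φ : ℝ) : Real.Angle)) = 0 := by
    rw [inner_N_T]; simp
  have lo := C.strictAnti_inner (a + φ) (a := a) (b := a + φ)
    ⟨by linarith, by linarith⟩ ⟨by linarith, le_rfl⟩ (by linarith)
  have hi : inner ℝ (N ((a + φ : ℝ) : Real.Angle)) (C.X a)
      < inner ℝ (N ((a + φ : ℝ) : Real.Angle)) (C.X ((a + φ + Real.pi : ℝ) : Real.Angle)) := by
    have := C.strictAnti_inner (a + φ) (a := a + φ + Real.pi - 2 * Real.pi) (b := a)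
      ⟨by linarith, by linarith⟩ ⟨by linarith, by linarith⟩ (by linarith)
    simpa only [X_sub_two_pi] using this
  obtain ⟨b, ⟨hb1, hb2⟩, hb⟩ := intermediate_value_Ioo (by linarith : a + φ ≤ a + φ + Real.pi)
    (C.continuous_inner (a + φ)).continuousOn ⟨lo, hi⟩
  refine ⟨((b : Real.Angle), ⟨b - a - φ, by linarith, by linarith⟩), ⟨?_, ?_⟩, ?_⟩
  · refine ⟨inner ℝ (T ((a + φ : ℝ) : Real.Angle)) (C.X b - C.X a), ?_, ?_⟩
    · have hp := C.inner_pos (a := a) (b := b) (by linarith) (by linarith)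
      have hd := decomp ((a + φ : ℝ) : Real.Angle) (C.X b - C.X a)
      have h0 : inner ℝ (N ((a + φ : ℝ) : Real.Angle)) (C.X b - C.X a) = 0 := by
        rw [inner_sub_right]; simpa [sub_eq_zero] using hb
      rw [h0, zero_smul, add_zero] at hd
      have h2 := congrArg (fun w => inner ℝ (N (a : Real.Angle)) w) hd
      simp only [inner_smul_right, inner_N_T, add_sub_cancel_left, inner_sub_right] at h2
      have hs := Real.sin_pos_of_pos_of_lt_pi hφ0 hφπ
      rw [inner_sub_right]
      exact pos_of_mul_pos_left (by rw [← h2]; linarith) hs.le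
    · rw [hout]
      have hd := decomp ((a + φ : ℝ) : Real.Angle) (C.X b - C.X a)
      have h0 : inner ℝ (N ((a + φ : ℝ) : Real.Angle)) (C.X b - C.X a) = 0 := by
        rw [inner_sub_right]; simpa [sub_eq_zero] using hb
      rw [h0, zero_smul, add_zero] at hd
      rw [← hd]; simp
  · rw [hout, dirIn_eq, ← Real.Angle.coe_sub]
    congr 2
    ring
  · rintro ⟨θ', φ', hφ'0, hφ'π⟩ ⟨⟨l, hl, hX⟩, hdir⟩
    rw [hout, dirIn_eq] at hdir
    have hθ := sub_eq_iff_eq_add.1 (T_injective hdir)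
    simp only at hθ
    rw [← Real.Angle.coe_add] at hθ
    subst hθ
    rw [hout] at hX
    have hb' : inner ℝ (N ((a + φ : ℝ) : Real.Angle)) (C.X ((a + φ + φ' : ℝ) : Real.Angle))
        = inner ℝ (N ((a + φ : ℝ) : Real.Angle)) (C.X a) := by
      simp only at hX
      rw [hX, inner_add_right, inner_smul_right, hNT, mul_zero, add_zero]
    have hbb : a + φ + φ' = b :=
      (C.strictMono_inner (a + φ)).injOn ⟨by linarith, by linarith⟩ ⟨hb1.le, hb2.le⟩
        (hb'.trans hb.symm)
    subst hbb
    congr 2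
    ring

/-- The billiard map `B : 𝕊¹ × (0, π) → 𝕊¹ × (0, π)`, sending `(θ, φ)` to the next impact. -/
def billiardMap (p : Phase) : Phase := (C.existsUnique_nextImpact p).choose

lemma billiardMap_spec (p : Phase) : C.IsNextImpact p (C.billiardMap p) :=
  (C.existsUnique_nextImpact p).choose_spec.1

/-- The width of the curve in the direction `u` (for a unit vector `u`): the distance between its
two supporting lines orthogonal to `u`. -/
def width (u : Plane) : ℝ :=
  sSup (range fun θ => inner ℝ u (C.X θ)) - sInf (range fun θ => inner ℝ u (C.X θ))

/-- The curve has the same (positive) width in all directions. -/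
def HasConstantWidth : Prop := ∃ d : ℝ, 0 < d ∧ ∀ u : Plane, ‖u‖ = 1 → C.width u = d

end Oval

/-- The orthogonal wavefront `Γ = {φ = π / 2}`. -/
def Γ : Set Phase := {p | (p.2 : ℝ) = Real.pi / 2}

/-- `S` is a graph over `Γ`, that is, the graph `{(θ, g(θ))}` of a function `g : 𝕊¹ → (0, π)`. -/
def IsGraph (S : Set Phase) : Prop :=
  ∃ g : Real.Angle → Ioo (0 : ℝ) Real.pi, S = range fun θ => ((θ, g θ) : Phase)

end Billiard

end

/-!
Consider polygonal paths `X(z₀), …, X(zₙ)` inscribed in the oval, with the last vertex prescribed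
and the first one free. A longest such path exists by compactness. Its consecutive vertices are
distinct, since a repeated vertex could be moved off the chord of its neighbours, so the first
variation of length applies: the first edge is orthogonal to the curve at `X(z₀)` and the reflection
law holds at the inner vertices. Hence a longest path is the trajectory of a point of `Γ`
(`IsLongest.eq_iterate`). As `B` is injective and `Bⁿ(Γ)` is a graph, only one point of `Γ` has
a trajectory whose `n`-th vertex is the prescribed one; so the trajectory of every point of `Γ` is
a longest path for each number of steps (`isLongest_of_isGraph`).

Let `a₀, a₁, …` be the lengths of the edges of such a trajectory, and compare its first `n` edges
with two competitors. The path running back and forth on the edge `aₙ` gives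
`n aₙ ≤ a₀ + ⋯ + aₙ₋₁`, hence `aₙ ≤ a₀` by induction. The path running back and forth on a longest
chord of the oval, of length `D`, before its last edge gives
`(n - 1) D ≤ a₀ + ⋯ + aₙ₋₁ ≤ n a₀` for all `n`, hence `a₀ = D` (`dist_le_of_forall_isLongest`).

So every chord leaving the curve orthogonally has the maximal length `D`. It is then orthogonal to
the curve at its other end too, which gives `B(Γ) = Γ`, and its length is the width of the oval in
its direction, which gives constant width.
-/

namespace Billiard

/-! ### The moving frame -/

lemma norm_T (θ : Real.Angle) : ‖T θ‖ = 1 := by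
  simp [T, EuclideanSpace.norm_eq, Fin.sum_univ_two, Real.Angle.cos_sq_add_sin_sq]

lemma norm_N (θ : Real.Angle) : ‖N θ‖ = 1 := by
  simp [N, EuclideanSpace.norm_eq, Fin.sum_univ_two, add_comm, Real.Angle.cos_sq_add_sin_sq]

lemma inner_T_T (θ : Real.Angle) : inner ℝ (T θ) (T θ) = 1 := by
  rw [real_inner_self_eq_norm_sq, norm_T, one_pow]

lemma inner_N_N (θ : Real.Angle) : inner ℝ (N θ) (N θ) = 1 := by
  rw [real_inner_self_eq_norm_sq, norm_N, one_pow]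

lemma inner_T_N (θ : Real.Angle) : inner ℝ (T θ) (N θ) = 0 := by
  simp [T, N, PiLp.inner_apply, Fin.sum_univ_two]; ring

lemma inner_N_T_self (θ : Real.Angle) : inner ℝ (N θ) (T θ) = 0 := by
  rw [real_inner_comm, inner_T_N]

lemma norm_sq_eq_frame (θ : Real.Angle) (w : Plane) :
    ‖w‖ ^ 2 = inner ℝ (T θ) w ^ 2 + inner ℝ (N θ) w ^ 2 := by
  conv_lhs => rw [← real_inner_self_eq_norm_sq, decomp θ w]
  simp only [inner_add_left, inner_add_right, inner_smul_left, inner_smul_right, inner_T_T,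
    inner_N_N, inner_T_N, inner_N_T_self]
  simp; ring

/-- A unit vector pointing to the inner side of a tangent line is known from its tangential
component. -/
lemma eq_of_inner_T_eq {θ : Real.Angle} {v w : Plane} (hv : ‖v‖ = 1) (hw : ‖w‖ = 1)
    (hvN : 0 < inner ℝ (N θ) v) (hwN : 0 < inner ℝ (N θ) w)
    (h : inner ℝ (T θ) v = inner ℝ (T θ) w) : v = w := by
  have h1 := norm_sq_eq_frame θ v
  have h2 := norm_sq_eq_frame θ w
  rw [hv] at h1
  rw [hw] at h2
  have h3 : inner ℝ (N θ) v = inner ℝ (N θ) w := by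
    rw [← sq_eq_sq₀ hvN.le hwN.le]
    rw [h] at h1
    linarith
  rw [decomp θ v, decomp θ w, h, h3]

lemma inner_T_dirOut (p : Phase) : inner ℝ (T p.1) (dirOut p) = Real.cos p.2 := by
  simp [dirOut, inner_add_right, inner_smul_right, norm_T, inner_T_N]

lemma inner_N_dirOut (p : Phase) : inner ℝ (N p.1) (dirOut p) = Real.sin p.2 := by
  simp [dirOut, inner_add_right, inner_smul_right, norm_N, inner_N_T_self]

lemma inner_T_dirIn (p : Phase) : inner ℝ (T p.1) (dirIn p) = Real.cos p.2 := by
  simp [dirIn, inner_sub_right, inner_smul_right, norm_T, inner_T_N]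

lemma norm_dirOut (p : Phase) : ‖dirOut p‖ = 1 := by rw [dirOut_eq, norm_T]

lemma sin_pos (p : Phase) : 0 < Real.sin p.2 := Real.sin_pos_of_mem_Ioo p.2.2

lemma phase_ext_of_cos {p q : Phase} (h : p.1 = q.1) (hc : Real.cos p.2 = Real.cos q.2) :
    p = q :=
  Prod.ext h (Subtype.ext
    (Real.injOn_cos (Ioo_subset_Icc_self p.2.2) (Ioo_subset_Icc_self q.2.2) hc))

lemma exists_dirIn_eq {θ : Real.Angle} {v : Plane} (hv : ‖v‖ = 1)
    (hN : inner ℝ (N θ) v < 0) : ∃ p : Phase, p.1 = θ ∧ dirIn p = v := by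
  have h := norm_sq_eq_frame θ v
  rw [hv] at h
  set c := inner ℝ (T θ) v with hc
  set s := inner ℝ (N θ) v with hs
  have hc1 : c < 1 := by nlinarith
  have hc2 : -1 < c := by nlinarith
  refine ⟨(θ, ⟨Real.arccos c, Real.arccos_pos.2 hc1, ?_⟩), rfl, ?_⟩
  · exact lt_of_le_of_ne (Real.arccos_le_pi c) fun h => by
      rw [Real.arccos_eq_pi] at h; linarith
  · have hsin : √(1 - c ^ 2) = -s := by
      rw [show 1 - c ^ 2 = (-s) ^ 2 by linarith, Real.sqrt_sq (by linarith)]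
    rw [decomp θ v, ← hc, ← hs]
    simp only [dirIn, Real.cos_arccos hc2.le hc1.le, Real.sin_arccos, hsin]
    module

lemma exists_N_eq {u : Plane} (hu : ‖u‖ = 1) : ∃ θ, N θ = u := by
  have h : u 0 ^ 2 + u 1 ^ 2 = 1 := by
    have := EuclideanSpace.real_norm_sq_eq u
    rw [hu, Fin.sum_univ_two] at this
    linarith
  have hz : ‖(⟨u 1, -u 0⟩ : ℂ)‖ = 1 := by
    rw [← sq_eq_sq₀ (norm_nonneg _) zero_le_one, Complex.sq_norm, Complex.normSq_mk]
    linarith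
  have hz0 : (⟨u 1, -u 0⟩ : ℂ) ≠ 0 := by
    rw [← norm_pos_iff, hz]; exact one_pos
  refine ⟨(Complex.arg ⟨u 1, -u 0⟩ : ℝ), ?_⟩
  ext i
  fin_cases i
  · simp [N, Complex.sin_arg, hz]
  · simp [N, Complex.cos_arg hz0, hz]

/-! ### The circle of angles and the points of `Γ` -/

instance : CompactSpace Real.Angle :=
  have : Fact (0 < 2 * Real.pi) := ⟨Real.two_pi_pos⟩
  inferInstanceAs (CompactSpace (AddCircle (2 * Real.pi)))

instance : Infinite Real.Angle := by
  have : Infinite (Ioo (0 : ℝ) Real.pi) := (Ioo_infinite Real.pi_pos).to_subtype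
  refine Infinite.of_injective (fun x : Ioo (0 : ℝ) Real.pi => ((x : ℝ) : Real.Angle))
    fun x y h => Subtype.ext ?_
  have h1 : ∀ x : Ioo (0 : ℝ) Real.pi, ((x : ℝ) : Real.Angle).toReal = x := fun x =>
    Real.Angle.toReal_coe_eq_self_iff.2 ⟨by linarith [x.2.1, Real.pi_pos], x.2.2.le⟩
  rw [← h1 x, ← h1 y]
  exact congrArg Real.Angle.toReal h

/-- The point of the orthogonal wavefront `Γ` over `θ`. -/
noncomputable def orthogonal (θ : Real.Angle) : Phase :=
  (θ, ⟨Real.pi / 2, Real.pi_div_two_pos, by linarith [Real.pi_pos]⟩)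

lemma orthogonal_mem_Γ (θ : Real.Angle) : orthogonal θ ∈ Γ := rfl

namespace Oval

variable (C : Oval)

/-! ### Chords of the oval -/

lemma continuous_X : Continuous C.X := by
  have h : Continuous fun s : ℝ => C.X (s : Real.Angle) :=
    continuous_iff_continuousAt.2 fun s => (C.hasDerivAt_X s).continuousAt
  exact QuotientAddGroup.isOpenQuotientMap_mk.isQuotientMap.continuous_iff.2 h

/-- The curve lies strictly on the inner side of each of its tangent lines. -/
lemma inner_N_lt {a b : Real.Angle} (h : b ≠ a) :
    inner ℝ (N a) (C.X a) < inner ℝ (N a) (C.X b) := by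
  have hr : ((b - a).toReal : Real.Angle) = b - a := Real.Angle.coe_toReal _
  have h0 : (b - a).toReal ≠ 0 := by
    rw [Ne, Real.Angle.toReal_eq_zero_iff, sub_eq_zero]; exact h
  have h1 := Real.Angle.neg_pi_lt_toReal (b - a)
  have h2 := Real.Angle.toReal_le_pi (b - a)
  have hpi := Real.pi_pos
  generalize (b - a).toReal = r at *
  obtain rfl : b = a + r := by rw [hr]; abel
  induction a using Real.Angle.induction_on with
  | _ a =>
  rcases lt_or_gt_of_ne h0 with hr0 | hr0
  · have := C.inner_pos (a := a) (b := a + r + 2 * Real.pi) (by linarith) (by linarith)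
    simpa using this
  · have := C.inner_pos (a := a) (b := a + r) (by linarith) (by linarith)
    simpa using this

lemma injective_X : Function.Injective C.X := by
  intro a b h
  by_contra hab
  have := C.inner_N_lt (Ne.symm hab)
  rw [h] at this
  exact lt_irrefl _ this

lemma dist_X_pos {a b : Real.Angle} (h : a ≠ b) : 0 < dist (C.X a) (C.X b) :=
  dist_pos.2 (C.injective_X.ne h)

/-- The unit vector pointing from `X(a)` to `X(b)`; it is `0` if `a = b`. -/
noncomputable def chordDir (a b : Real.Angle) : Plane :=
  (dist (C.X a) (C.X b))⁻¹ • (C.X b - C.X a)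

lemma chordDir_swap (a b : Real.Angle) : C.chordDir b a = -C.chordDir a b := by
  rw [chordDir, chordDir, dist_comm, ← smul_neg, neg_sub]

lemma norm_chordDir {a b : Real.Angle} (h : a ≠ b) : ‖C.chordDir a b‖ = 1 := by
  have := C.dist_X_pos h
  rw [chordDir, norm_smul, norm_inv, Real.norm_of_nonneg this.le, ← dist_eq_norm, dist_comm]
  rw [dist_comm] at this
  exact inv_mul_cancel₀ this.ne'

lemma X_eq_add_chordDir {a b : Real.Angle} (h : a ≠ b) :
    C.X b = C.X a + dist (C.X a) (C.X b) • C.chordDir a b := by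
  rw [chordDir, smul_smul, mul_inv_cancel₀ (C.dist_X_pos h).ne', one_smul, add_sub_cancel]

lemma inner_N_chordDir_pos {a b : Real.Angle} (h : a ≠ b) :
    0 < inner ℝ (N a) (C.chordDir a b) := by
  rw [chordDir, inner_smul_right, inner_sub_right]
  exact mul_pos (inv_pos.2 (C.dist_X_pos h)) (sub_pos.2 (C.inner_N_lt h.symm))

/-- First variation of the length of a chord with one fixed end. -/
lemma hasDerivAt_dist {s : ℝ} {b : Real.Angle} (h : (s : Real.Angle) ≠ b) :
    HasDerivAt (fun t : ℝ => dist (C.X t) (C.X b))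
      (-(C.R s * inner ℝ (T s) (C.chordDir s b))) s := by
  have hd := C.dist_X_pos h
  have h1 := (((C.hasDerivAt_X s).sub_const (C.X b)).norm_sq).sqrt
    (by rw [← dist_eq_norm]; positivity)
  simp only [← dist_eq_norm, Real.sqrt_sq dist_nonneg] at h1
  convert h1 using 1
  rw [chordDir, inner_smul_right, inner_smul_right, real_inner_comm (T s) (C.X s - C.X b),
    ← neg_sub (C.X s) (C.X b), inner_neg_right]
  field_simp

/-- A vertex that maximizes the length of its two adjacent edges satisfies the reflection law. -/
lemma inner_T_chordDir_of_isMax {a b c : Real.Angle} (hab : a ≠ b) (hbc : b ≠ c)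
    (hmax : ∀ w, dist (C.X w) (C.X a) + dist (C.X w) (C.X c)
      ≤ dist (C.X b) (C.X a) + dist (C.X b) (C.X c)) :
    inner ℝ (T b) (C.chordDir b c) = inner ℝ (T b) (C.chordDir a b) := by
  induction b using Real.Angle.induction_on with
  | _ s =>
  have h0 := IsLocalMax.hasDerivAt_eq_zero (Filter.Eventually.of_forall fun t : ℝ => hmax t)
    ((C.hasDerivAt_dist hab.symm).add (C.hasDerivAt_dist hbc))
  rw [chordDir_swap, inner_neg_right] at h0
  have := C.R_pos s
  have : C.R s * (inner ℝ (T s) (C.chordDir s c) - inner ℝ (T s) (C.chordDir a s)) = 0 := by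
    linarith
  rcases mul_eq_zero.1 this with h | h <;> linarith

/-- A longest chord with one fixed end is orthogonal to the curve at its other end. -/
lemma inner_T_chordDir_eq_zero_of_isMax {b c : Real.Angle} (hbc : b ≠ c)
    (hmax : ∀ w, dist (C.X w) (C.X c) ≤ dist (C.X b) (C.X c)) :
    inner ℝ (T b) (C.chordDir b c) = 0 := by
  induction b using Real.Angle.induction_on with
  | _ s =>
  have h0 := IsLocalMax.hasDerivAt_eq_zero (Filter.Eventually.of_forall fun t : ℝ => hmax t)
    (C.hasDerivAt_dist hbc)
  have := C.R_pos s
  rcases mul_eq_zero.1 (neg_eq_zero.1 h0) with h | h <;> linarith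

/-- No third point of the oval lies on a chord. -/
lemma dist_lt_dist_add_dist {a b w : Real.Angle} (ha : w ≠ a) (hb : w ≠ b) :
    dist (C.X a) (C.X b) < dist (C.X w) (C.X a) + dist (C.X w) (C.X b) := by
  rw [dist_comm (C.X w) (C.X a)]
  refine lt_of_le_of_ne (dist_triangle _ _ _) fun h => ?_
  obtain ⟨t, ⟨ht0, ht1⟩, ht⟩ := dist_add_dist_eq_iff.1 h.symm
  have h1 := congrArg (fun v => inner ℝ (N w) v) ht
  simp only [AffineMap.lineMap_apply_module, inner_add_right, inner_smul_right] at h1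
  have h2 := C.inner_N_lt ha.symm
  have h3 := C.inner_N_lt hb.symm
  rcases ht0.eq_or_lt with rfl | ht0
  · linarith
  · nlinarith

/-! ### The billiard map in terms of chords -/

lemma billiardMap_eq {p q : Phase} (h : C.IsNextImpact p q) : C.billiardMap p = q :=
  (C.existsUnique_nextImpact p).unique (C.billiardMap_spec p) h

lemma billiardMap_fst_ne (p : Phase) : p.1 ≠ (C.billiardMap p).1 := by
  obtain ⟨⟨l, hl, hX⟩, -⟩ := C.billiardMap_spec p
  intro h
  rw [← h, left_eq_add, smul_eq_zero] at hX
  rcases hX with h0 | h0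
  · exact hl.ne' h0
  · have := norm_dirOut p
    rw [h0, norm_zero] at this
    exact zero_ne_one this

lemma billiardMap_fst_of_dirOut {p : Phase} {b : Real.Angle} (hb : p.1 ≠ b)
    (h : dirOut p = C.chordDir p.1 b) : (C.billiardMap p).1 = b := by
  have hN : inner ℝ (N b) (C.chordDir p.1 b) < 0 := by
    rw [chordDir_swap, inner_neg_right]
    linarith [C.inner_N_chordDir_pos hb.symm]
  obtain ⟨q, rfl, hq⟩ := exists_dirIn_eq (C.norm_chordDir hb) hN
  rw [C.billiardMap_eq (q := q) ⟨⟨_, C.dist_X_pos hb, ?_⟩, hq.trans h.symm⟩]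
  rw [h]
  exact C.X_eq_add_chordDir hb

lemma injective_billiardMap : Function.Injective C.billiardMap := by
  intro p p' h
  obtain ⟨⟨l, -, hX⟩, hd⟩ := C.billiardMap_spec p
  obtain ⟨⟨l', -, hX'⟩, hd'⟩ := C.billiardMap_spec p'
  rw [← h] at hX' hd'
  have hdd : dirOut p = dirOut p' := hd.symm.trans hd'
  -- Both starting points lie on the same line, and each sees the other ahead of it.
  have h1 : p.1 = p'.1 := by
    by_contra hne
    have hXX : C.X p'.1 = C.X p.1 + (l - l') • dirOut p := by
      have : C.X p.1 + l • dirOut p = C.X p'.1 + l' • dirOut p := by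
        rw [← hX, hX', hdd]
      rw [sub_smul, ← add_sub_assoc, this, add_sub_cancel_right]
    have ha := C.inner_N_lt (Ne.symm hne)
    have hb := C.inner_N_lt hne
    rw [hXX, inner_add_right, inner_smul_right, inner_N_dirOut] at ha
    rw [hXX, inner_add_right, inner_smul_right, hdd, inner_N_dirOut] at hb
    have := sin_pos p
    have := sin_pos p'
    rcases le_total l l' with hl | hl <;> nlinarith
  refine phase_ext_of_cos h1 ?_
  rw [← inner_T_dirOut, ← inner_T_dirOut, hdd, h1]

/-! ### Longest polygonal paths -/

/-- The length of the polygonal path with the `n + 1` vertices `X(z 0), …, X(z n)`; the later terms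
of the sequence `z` play no role. -/
noncomputable def pathLength (z : ℕ → Real.Angle) (n : ℕ) : ℝ :=
  ∑ i ∈ Finset.range n, dist (C.X (z i)) (C.X (z (i + 1)))

lemma pathLength_succ (z : ℕ → Real.Angle) (n : ℕ) :
    C.pathLength z (n + 1) = C.pathLength z n + dist (C.X (z n)) (C.X (z (n + 1))) :=
  Finset.sum_range_succ _ _

/-- The path is a longest one among those with the same number of edges and the same last vertex;
the first vertex is free. -/
def IsLongest (z : ℕ → Real.Angle) (n : ℕ) : Prop :=
  ∀ w : ℕ → Real.Angle, w n = z n → C.pathLength w n ≤ C.pathLength z n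

lemma exists_isLongest (n : ℕ) (y : Real.Angle) : ∃ z, z n = y ∧ C.IsLongest z n := by
  have hc : Continuous fun z : ℕ → Real.Angle => C.pathLength z n := by
    have := C.continuous_X
    unfold pathLength
    fun_prop
  have hK : IsCompact {z : ℕ → Real.Angle | z n = y} :=
    (isClosed_singleton.preimage (continuous_apply n)).isCompact
  obtain ⟨z, hz, hmax⟩ := hK.exists_isMaxOn ⟨fun _ => y, rfl⟩ hc.continuousOn
  exact ⟨z, hz, fun w hw => hmax (hw.trans hz)⟩

variable {C} {z : ℕ → Real.Angle} {n : ℕ}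

lemma IsLongest.dist_zero_le (hz : C.IsLongest z (n + 1)) (w : Real.Angle) :
    dist (C.X w) (C.X (z 1)) ≤ dist (C.X (z 0)) (C.X (z 1)) := by
  have h := hz (Function.update z 0 w) (by simp)
  simp only [pathLength, Finset.sum_range_succ'] at h
  simpa using h

lemma IsLongest.dist_add_dist_le (hz : C.IsLongest z n) {k : ℕ} (hk : k + 1 < n)
    (w : Real.Angle) :
    dist (C.X w) (C.X (z k)) + dist (C.X w) (C.X (z (k + 2)))
      ≤ dist (C.X (z (k + 1))) (C.X (z k)) + dist (C.X (z (k + 1))) (C.X (z (k + 2))) := by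
  have h := hz (Function.update z (k + 1) w) (by simp [hk.ne'])
  have hk1 : k + 1 ∈ (Finset.range n).erase k := by simp [hk]
  have hk0 : k ∈ Finset.range n := by simp; omega
  -- Only the edges `k` and `k + 1` change when the vertex `k + 1` moves.
  have hsum : ∀ v : ℕ → Real.Angle, C.pathLength v n =
      dist (C.X (v k)) (C.X (v (k + 1))) + (dist (C.X (v (k + 1))) (C.X (v (k + 2))) +
        ∑ i ∈ ((Finset.range n).erase k).erase (k + 1), dist (C.X (v i)) (C.X (v (i + 1)))) :=
    fun v => by rw [pathLength, ← Finset.add_sum_erase _ _ hk0, ← Finset.add_sum_erase _ _ hk1]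
  rw [hsum, hsum z] at h
  have hrest : ∑ i ∈ ((Finset.range n).erase k).erase (k + 1),
      dist (C.X (Function.update z (k + 1) w i)) (C.X (Function.update z (k + 1) w (i + 1)))
      = ∑ i ∈ ((Finset.range n).erase k).erase (k + 1), dist (C.X (z i)) (C.X (z (i + 1))) := by
    refine Finset.sum_congr rfl fun i hi => ?_
    simp only [Finset.mem_erase] at hi
    rw [Function.update_of_ne (by omega), Function.update_of_ne (by omega)]
  rw [hrest, Function.update_self, Function.update_of_ne (by omega),
    Function.update_of_ne (by omega)] at h
  rw [dist_comm (C.X w), dist_comm (C.X (z (k + 1))) (C.X (z k))]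
  linarith

lemma IsLongest.ne_succ (hz : C.IsLongest z n) {k : ℕ} (hk : k < n) : z k ≠ z (k + 1) := by
  intro h
  rcases k with _ | k
  · obtain ⟨m, rfl⟩ : ∃ m, n = m + 1 := ⟨n - 1, by omega⟩
    obtain ⟨w, hw⟩ := exists_ne (z 1)
    have h1 := hz.dist_zero_le w
    rw [zero_add] at h
    rw [h, dist_self] at h1
    exact absurd (C.dist_X_pos hw) (not_lt.2 h1)
  · -- A vertex that repeats its successor can be moved off the chord of its two neighbours.
    obtain ⟨w, hw⟩ := ({z k, z (k + 2)} : Set Real.Angle).toFinite.infinite_compl.nonempty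
    simp only [mem_compl_iff, mem_insert_iff, mem_singleton_iff, not_or] at hw
    have h1 := hz.dist_add_dist_le hk w
    have h2 := C.dist_lt_dist_add_dist hw.1 hw.2
    rw [h, dist_self, add_zero, dist_comm (C.X (z (k + 1 + 1)))] at h1
    exact absurd h1 (not_le.2 h2)

/-- A longest path is a billiard trajectory leaving its first vertex orthogonally. -/
lemma IsLongest.eq_iterate (hz : C.IsLongest z n) {p : Phase} (hp : p ∈ Γ) (hp0 : p.1 = z 0)
    {k : ℕ} (hk : k ≤ n) : (C.billiardMap^[k] p).1 = z k := by
  suffices H : ∀ k ≤ n, (C.billiardMap^[k] p).1 = z k ∧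
      (k < n → dirOut (C.billiardMap^[k] p) = C.chordDir (z k) (z (k + 1))) from (H k hk).1
  intro k
  induction k with
  | zero =>
    refine fun _ => ⟨hp0, fun hn => ?_⟩
    obtain ⟨m, rfl⟩ : ∃ m, n = m + 1 := ⟨n - 1, by omega⟩
    have hne := hz.ne_succ hn
    refine eq_of_inner_T_eq (θ := z 0) (norm_dirOut _) (C.norm_chordDir hne) ?_
      (C.inner_N_chordDir_pos hne) ?_
    · rw [Function.iterate_zero, id, ← hp0, inner_N_dirOut]
      exact sin_pos p
    · rw [zero_add, C.inner_T_chordDir_eq_zero_of_isMax hne hz.dist_zero_le,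
        Function.iterate_zero, id, ← hp0, inner_T_dirOut, show (p.2 : ℝ) = Real.pi / 2 from hp,
        Real.cos_pi_div_two]
  | succ k ih =>
    intro hk
    obtain ⟨h1, h2⟩ := ih (by omega)
    have hne := hz.ne_succ (k := k) (by omega)
    have h2 := h2 (by omega)
    have h3 : (C.billiardMap^[k + 1] p).1 = z (k + 1) := by
      rw [Function.iterate_succ_apply']
      exact C.billiardMap_fst_of_dirOut (by rwa [h1]) (by rwa [h1])
    refine ⟨h3, fun hk' => ?_⟩
    have hne' := hz.ne_succ hk'
    refine eq_of_inner_T_eq (θ := z (k + 1)) (norm_dirOut _) (C.norm_chordDir hne') ?_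
      (C.inner_N_chordDir_pos hne') ?_
    · rw [← h3, inner_N_dirOut]
      exact sin_pos _
    · rw [C.inner_T_chordDir_of_isMax hne hne' (hz.dist_add_dist_le hk'), ← h2, ← h3,
        inner_T_dirOut, ← inner_T_dirIn, Function.iterate_succ_apply',
        (C.billiardMap_spec (C.billiardMap^[k] p)).2]

variable (C)

/-- If `Bⁿ(Γ)` is a graph, then trajectories leaving orthogonally are longest paths: some longest
path ends at the given vertex, it is such a trajectory, and no two of these share their `n`-th
vertex. -/
lemma isLongest_of_isGraph (hgraph : IsGraph (C.billiardMap^[n] '' Γ)) {p : Phase} (hp : p ∈ Γ) :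
    C.IsLongest (fun k => (C.billiardMap^[k] p).1) n := by
  obtain ⟨z, hzn, hz⟩ := C.exists_isLongest n (C.billiardMap^[n] p).1
  set q := orthogonal (z 0)
  have hqΓ : q ∈ Γ := orthogonal_mem_Γ _
  have horb : ∀ k ≤ n, (C.billiardMap^[k] q).1 = z k := fun k hk => hz.eq_iterate hqΓ rfl hk
  obtain ⟨g, hg⟩ := hgraph
  have hpg : C.billiardMap^[n] p ∈ range fun θ => ((θ, g θ) : Phase) := hg ▸ mem_image_of_mem _ hp
  have hqg : C.billiardMap^[n] q ∈ range fun θ => ((θ, g θ) : Phase) := hg ▸ mem_image_of_mem _ hqΓ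
  obtain ⟨a, ha⟩ := hpg
  obtain ⟨b, hb⟩ := hqg
  have hab : a = b := by
    have h := (horb n le_rfl).trans hzn
    rw [← ha, ← hb] at h
    exact h.symm
  have hpq : p = q := C.injective_billiardMap.iterate n (by rw [← ha, ← hb, hab])
  have hlen : C.pathLength (fun k => (C.billiardMap^[k] p).1) n = C.pathLength z n := by
    refine Finset.sum_congr rfl fun i hi => ?_
    have hi := Finset.mem_range.1 hi
    simp only [hpq, horb i (by omega), horb (i + 1) (by omega)]
  intro w hw
  rw [hlen]
  exact hz w (hw.trans hzn.symm)

/-! ### Comparison with paths running back and forth on a chord -/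

/-- Comparison with the path that runs back and forth on the chord following a longest path. -/
lemma IsLongest.mul_dist_le {C : Oval} (hz : C.IsLongest z n) :
    n * dist (C.X (z n)) (C.X (z (n + 1))) ≤ C.pathLength z n := by
  have h := hz (fun i => if Even (n + i) then z n else z (n + 1)) (by simp)
  refine le_trans (le_of_eq ?_) h
  rw [pathLength, Finset.sum_congr rfl (g := fun _ => dist (C.X (z n)) (C.X (z (n + 1))))]
  · simp
  · intro i _
    by_cases hi : Even (n + i)
    · simp [← add_assoc, Nat.even_add_one, hi]
    · simp [← add_assoc, Nat.even_add_one, hi, dist_comm]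

/-- Comparison with the path that runs back and forth on an arbitrary chord before its last
edge. -/
lemma IsLongest.mul_dist_le_of_succ {C : Oval} (hz : C.IsLongest z (n + 1)) (a b : Real.Angle) :
    n * dist (C.X a) (C.X b) ≤ C.pathLength z (n + 1) := by
  have h := hz (fun i => if i = n + 1 then z (n + 1) else if Even i then a else b) (by simp)
  refine le_trans ?_ h
  rw [pathLength_succ]
  refine le_trans (le_of_eq ?_) (le_add_of_nonneg_right dist_nonneg)
  rw [pathLength, Finset.sum_congr rfl (g := fun _ => dist (C.X a) (C.X b))]
  · simp
  · intro i hi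
    have hi := Finset.mem_range.1 hi
    have hi0 : i ≠ n + 1 := by omega
    by_cases h : Even i
    · simp [Nat.even_add_one, h, hi0, hi.ne]
    · simp [Nat.even_add_one, h, hi0, hi.ne, dist_comm]

/-- If all initial pieces of an infinite path are longest, then its first edge is at least as long
as every chord. -/
lemma dist_le_of_forall_isLongest (hz : ∀ n, C.IsLongest z n) (a b : Real.Angle) :
    dist (C.X a) (C.X b) ≤ dist (C.X (z 0)) (C.X (z 1)) := by
  have hfirst : ∀ n, C.pathLength z n ≤ n * dist (C.X (z 0)) (C.X (z 1)) := by
    intro n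
    induction n with
    | zero => simp [pathLength]
    | succ n ih =>
      rw [pathLength_succ]
      rcases n.eq_zero_or_pos with rfl | hn
      · simp [pathLength]
      · have h1 := ((hz n).mul_dist_le).trans ih
        have h2 := le_of_mul_le_mul_left h1 (Nat.cast_pos.2 hn)
        push_cast
        linarith
  by_contra! hlt
  obtain ⟨m, hm⟩ := exists_nat_gt
    (dist (C.X (z 0)) (C.X (z 1)) / (dist (C.X a) (C.X b) - dist (C.X (z 0)) (C.X (z 1))))
  rw [div_lt_iff₀ (sub_pos.2 hlt)] at hm
  have h1 := ((hz (m + 1)).mul_dist_le_of_succ a b).trans (hfirst (m + 1))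
  push_cast at h1
  linarith

/-! ### Orthogonal chords and constant width -/

/-- If `B(p) ∈ Γ` for some `p ∈ Γ`, the two ends have opposite normals. -/
lemma N_billiardMap {p : Phase} (hp : p ∈ Γ) (hq : C.billiardMap p ∈ Γ) :
    N (C.billiardMap p).1 = -N p.1 := by
  have h := (C.billiardMap_spec p).2
  have hp' : (p.2 : ℝ) = Real.pi / 2 := hp
  have hq' : ((C.billiardMap p).2 : ℝ) = Real.pi / 2 := hq
  simp only [dirIn, dirOut, hp', hq', Real.cos_pi_div_two, Real.sin_pi_div_two, zero_smul, one_smul,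
    zero_sub, zero_add] at h
  rw [← h, neg_neg]

/-- A chord orthogonal to the curve at both ends is traversed back and forth. -/
lemma billiardMap_billiardMap {p : Phase} (hp : p ∈ Γ) (hq : C.billiardMap p ∈ Γ) :
    C.billiardMap (C.billiardMap p) = p := by
  have hN := C.N_billiardMap hp hq
  obtain ⟨⟨l, hl, hX⟩, -⟩ := C.billiardMap_spec p
  have hp' : (p.2 : ℝ) = Real.pi / 2 := hp
  have hq' : ((C.billiardMap p).2 : ℝ) = Real.pi / 2 := hq
  refine C.billiardMap_eq ⟨⟨l, hl, ?_⟩, ?_⟩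
  · rw [hX]
    simp [dirOut, hp', hq', hN]
  · simp [dirIn, dirOut, hp', hq', hN]

lemma billiardMap_mem_Γ_of_isMax {p : Phase}
    (hmax : ∀ w, dist (C.X w) (C.X p.1) ≤ dist (C.X (C.billiardMap p).1) (C.X p.1)) :
    C.billiardMap p ∈ Γ := by
  have hne := C.billiardMap_fst_ne p
  have h0 := C.inner_T_chordDir_eq_zero_of_isMax hne.symm hmax
  obtain ⟨⟨l, hl, hX⟩, hd⟩ := C.billiardMap_spec p
  have hdir : C.chordDir (C.billiardMap p).1 p.1 =
      -((dist (C.X (C.billiardMap p).1) (C.X p.1))⁻¹ * l) • dirIn (C.billiardMap p) := by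
    rw [chordDir, hd, show C.X p.1 - C.X (C.billiardMap p).1 = -(l • dirOut p) by rw [hX]; abel,
      smul_neg, smul_smul, neg_smul]
  rw [hdir, inner_smul_right, inner_T_dirIn] at h0
  have hpos := mul_pos (inv_pos.2 (C.dist_X_pos hne.symm)) hl
  have hcos : Real.cos (C.billiardMap p).2 = 0 :=
    (mul_eq_zero.1 h0).resolve_left (neg_ne_zero.2 hpos.ne')
  exact congrArg (fun q : Phase => (q.2 : ℝ)) (phase_ext_of_cos (p := C.billiardMap p)
    (q := orthogonal (C.billiardMap p).1) rfl (hcos.trans Real.cos_pi_div_two.symm))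

/-- The width in a normal direction is attained on a chord orthogonal to the curve at both ends. -/
lemma width_N {p : Phase} (hp : p ∈ Γ) (hq : C.billiardMap p ∈ Γ) :
    C.width (N p.1) = dist (C.X p.1) (C.X (C.billiardMap p).1) := by
  have hN := C.N_billiardMap hp hq
  obtain ⟨⟨l, hl, hX⟩, -⟩ := C.billiardMap_spec p
  have hdist : dist (C.X p.1) (C.X (C.billiardMap p).1) = l := by
    rw [hX, dist_self_add_right, norm_smul, norm_dirOut, mul_one, Real.norm_of_nonneg hl.le]
  have hmin : IsLeast (range fun θ => inner ℝ (N p.1) (C.X θ)) (inner ℝ (N p.1) (C.X p.1)) := by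
    refine ⟨⟨p.1, rfl⟩, ?_⟩
    rintro _ ⟨θ, rfl⟩
    rcases eq_or_ne θ p.1 with rfl | h
    · exact le_rfl
    · exact (C.inner_N_lt h).le
  have hmax : IsGreatest (range fun θ => inner ℝ (N p.1) (C.X θ))
      (inner ℝ (N p.1) (C.X (C.billiardMap p).1)) := by
    refine ⟨⟨_, rfl⟩, ?_⟩
    rintro _ ⟨θ, rfl⟩
    rcases eq_or_ne θ (C.billiardMap p).1 with rfl | h
    · exact le_rfl
    · have := C.inner_N_lt h
      rw [hN, inner_neg_left, inner_neg_left] at this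
      exact (neg_lt_neg_iff.1 this).le
  rw [width, hmax.csSup_eq, hmin.csInf_eq, hdist, hX, inner_add_right, inner_smul_right,
    inner_N_dirOut, show (p.2 : ℝ) = Real.pi / 2 from hp, Real.sin_pi_div_two]
  ring

end Oval

end Billiard

open Billiard in
theorem mainTheorem8 (C : Billiard.Oval)
    (hgraph : ∀ n : ℕ, 0 < n → Billiard.IsGraph (C.billiardMap^[n] '' Billiard.Γ)) :
    C.billiardMap '' Billiard.Γ = Billiard.Γ ∧ C.HasConstantWidth := by
  have hlong : ∀ p ∈ Γ, ∀ n, C.IsLongest (fun k => (C.billiardMap^[k] p).1) n := by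
    intro p hp n
    rcases n.eq_zero_or_pos with rfl | hn
    · intro w _
      simp [Oval.pathLength]
    · exact C.isLongest_of_isGraph (hgraph n hn) hp
  have hdiam : ∀ p ∈ Γ, ∀ a b,
      dist (C.X a) (C.X b) ≤ dist (C.X p.1) (C.X (C.billiardMap p).1) :=
    fun p hp a b => C.dist_le_of_forall_isLongest (hlong p hp) a b
  have hΓ : ∀ p ∈ Γ, C.billiardMap p ∈ Γ := fun p hp =>
    C.billiardMap_mem_Γ_of_isMax fun w => by
      rw [dist_comm (C.X (C.billiardMap p).1)]
      exact hdiam p hp _ _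
  refine ⟨Set.Subset.antisymm (Set.image_subset_iff.2 hΓ) fun p hp =>
    ⟨C.billiardMap p, hΓ p hp, C.billiardMap_billiardMap hp (hΓ p hp)⟩, ?_⟩
  refine ⟨_, C.dist_X_pos (C.billiardMap_fst_ne (orthogonal 0)), fun u hu => ?_⟩
  obtain ⟨θ, rfl⟩ := exists_N_eq hu
  have hp := orthogonal_mem_Γ θ
  exact (C.width_N hp (hΓ _ hp)).trans
    (le_antisymm (hdiam _ (orthogonal_mem_Γ 0) _ _) (hdiam _ hp _ _))
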